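/- Let $Z$ be a metric space, let $\mu$ be a Borel measure on $Z$, and let $X=\operatorname{supp}\mu$ be its support, the set of all points of $Z$ each of whose neighbourhoods has positive measure. (The case $Z=X$ is included.) For $x\in X$ and $r>0$ write $B_X(x,r)=\{y\in X: d(x,y)<r\}$. Assume that $X$ is topologically connected and that $\mu$ is doubling, that is, $\mu(B_X(x,r))<\infty$ for all $x\in X$, $r>0$, and there is a constant $C_\mu$ with $$\mu(B_X(x,2r))\le C_\mu\,\mu(B_X(x,r))\qquad\text{for all }x\in X,\ r>0 .$$ Let $E\subseteq X$ be compact. Then the following are equivalent. 1. $E$ is $(\mu,1)$-rectifiable: there are sets $E_i\subseteq\mathbb{R}$ and Lipschitz maps $f_i:E_i\to Z$, $i=1,2,\dots$, with $\mu\bigl(E\setminus\bigcup_{i} f_i(E_i)\bigr)=0$. 2. The lower $1$-density is positive almost everywhere on $E$: for $\mu$-almost every $x\in E$, $$\underline{D}^1(\mu,x):=\liminf_{r\to0^+}\frac{\mu(B_X(x,r))}{r}>0 .$$ -/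

import Mathlib

open MeasureTheory Filter Topology
open scoped ENNReal NNReal

/-- `μ` is doubling on the metric subspace `X` of `Z`. Here `Metric.ball x r ∩ X` is the ball
`B_X(x, r)` of the metric space `X`. As usual for doubling measures, balls have finite measure
(positivity is automatic when `X` is the support of `μ` and carries `μ`). -/
structure IsDoublingOn {Z : Type*} [MetricSpace Z] [MeasurableSpace Z]
    (μ : Measure Z) (X : Set Z) : Prop where
  measure_ball_lt_top : ∀ x ∈ X, ∀ r : ℝ, 0 < r → μ (Metric.ball x r ∩ X) < ∞
  exists_measure_ball_le : ∃ C : ℝ≥0, ∀ x ∈ X, ∀ r : ℝ, 0 < r →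
    μ (Metric.ball x (2 * r) ∩ X) ≤ C * μ (Metric.ball x r ∩ X)

/-- The lower `s`-density `liminf_{r → 0+} μ(B_X(x, r)) / r ^ s`, with values in `[0, ∞]`. -/
noncomputable def lowerDensity {Z : Type*} [MetricSpace Z] [MeasurableSpace Z]
    (μ : Measure Z) (X : Set Z) (s : ℝ) (x : Z) : ℝ≥0∞ :=
  liminf (fun r : ℝ => μ (Metric.ball x r ∩ X) / ENNReal.ofReal (r ^ s)) (𝓝[>] 0)

/-- `E` is `(μ, 1)`-rectifiable: up to a `μ`-null set, `E` is covered by countably many images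
of subsets of `ℝ` (possibly empty, not necessarily measurable) under Lipschitz maps. -/
def IsOneRectifiable {Z : Type*} [MetricSpace Z] [MeasurableSpace Z]
    (μ : Measure Z) (E : Set Z) : Prop :=
  ∃ (A : ℕ → Set ℝ) (f : ∀ i, A i → Z),
    (∀ i, ∃ K : ℝ≥0, LipschitzWith K (f i)) ∧ μ (E \ ⋃ i, Set.range (f i)) = 0

/-- `K` admits a closed tour of length `ℓ` from each of its points: visiting times `t` that start
at `0`, whose differences dominate distances, and that leave enough time to return to the base. -/
def HasTour {Z : Type*} [MetricSpace Z] (K : Set Z) (ℓ : ℝ) : Prop :=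
  ∀ p ∈ K, ∃ t : Z → ℝ, t p = 0 ∧ (∀ x ∈ K, 0 ≤ t x ∧ dist x p ≤ ℓ - t x) ∧
    ∀ x ∈ K, ∀ y ∈ K, dist x y ≤ |t x - t y|

section Tour

variable {Z : Type*} [MetricSpace Z]

lemma hasTour_singleton (x : Z) : HasTour {x} 0 := by
  rintro p rfl
  refine ⟨fun _ => 0, rfl, ?_, ?_⟩ <;> simp

/-- A closed tour can be started at any of its points. -/
lemma HasTour.of_base {K : Set Z} {ℓ : ℝ} {p : Z} (hp : p ∈ K) {t : Z → ℝ} (htp : t p = 0)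
    (ht : ∀ x ∈ K, 0 ≤ t x ∧ dist x p ≤ ℓ - t x)
    (hd : ∀ x ∈ K, ∀ y ∈ K, dist x y ≤ |t x - t y|) : HasTour K ℓ := by
  intro q hq
  have hpq : ∀ x ∈ K, dist x p ≤ t x := fun x hx => by
    have := hd x hx p hp
    rwa [htp, sub_zero, abs_of_nonneg (ht x hx).1] at this
  have hbound : ∀ x ∈ K, t x ≤ ℓ := fun x hx => by
    linarith [(ht x hx).2, dist_nonneg (x := x) (y := p)]
  have hcross : ∀ x ∈ K, ∀ y ∈ K, dist x y ≤ ℓ - t x + t y := fun x hx y hy => by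
    linarith [dist_triangle_right x y p, (ht x hx).2, hpq y hy]
  refine ⟨fun x => if t q ≤ t x then t x - t q else t x + ℓ - t q, by simp, ?_, ?_⟩
  · intro x hx
    by_cases h : t q ≤ t x
    · simp only [h, if_true]
      exact ⟨by linarith, by linarith [hcross x hx q hq]⟩
    · simp only [h, if_false]
      push Not at h
      refine ⟨by linarith [(ht x hx).1, hbound q hq], ?_⟩
      have := hd x hx q hq
      rw [abs_of_neg (by linarith)] at this
      linarith
  · intro x hx y hy
    by_cases h : t q ≤ t x <;> by_cases h' : t q ≤ t y <;> simp only [h, h', if_true, if_false]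
    · simpa using hd x hx y hy
    · refine le_trans ?_ (neg_le_abs _)
      linarith [hcross x hx y hy]
    · refine le_trans ?_ (le_abs_self _)
      have := hcross y hy x hx
      rw [dist_comm] at this
      linarith
    · have := hd x hx y hy
      rwa [show t x + ℓ - t q - (t y + ℓ - t q) = t x - t y by ring]

lemma HasTour.union {K₁ K₂ : Set Z} {ℓ₁ ℓ₂ s : ℝ} (h₁ : HasTour K₁ ℓ₁) (h₂ : HasTour K₂ ℓ₂)
    {x₁ x₂ : Z} (hx₁ : x₁ ∈ K₁) (hx₂ : x₂ ∈ K₂) (hs : dist x₁ x₂ ≤ s) :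
    HasTour (K₁ ∪ K₂) (ℓ₁ + ℓ₂ + 2 * s) := by
  classical
  obtain ⟨t₁, h₁0, h₁r, h₁d⟩ := h₁ x₁ hx₁
  obtain ⟨t₂, h₂0, h₂r, h₂d⟩ := h₂ x₂ hx₂
  have hs0 : 0 ≤ s := dist_nonneg.trans hs
  have hℓ₁ : 0 ≤ ℓ₁ := by simpa [h₁0] using (h₁r x₁ hx₁).2
  have hℓ₂ : 0 ≤ ℓ₂ := by simpa [h₂0] using (h₂r x₂ hx₂).2
  have hd₂ : ∀ y ∈ K₂, dist x₂ y ≤ t₂ y := fun y hy => by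
    have := h₂d y hy x₂ hx₂
    rwa [h₂0, sub_zero, abs_of_nonneg (h₂r y hy).1, dist_comm] at this
  have hcross : ∀ x ∈ K₁, ∀ y ∈ K₂, dist x y ≤ ℓ₁ + s + t₂ y - t₁ x := fun x hx y hy => by
    linarith [dist_triangle4 x x₁ x₂ y, (h₁r x hx).2, hd₂ y hy]
  refine HasTour.of_base (p := x₁) (Or.inl hx₁)
    (t := fun x => if x ∈ K₁ then t₁ x else ℓ₁ + s + t₂ x) (by simp [hx₁, h₁0]) ?_ ?_
  · intro x hx
    by_cases h : x ∈ K₁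
    · simp only [h, if_true]
      exact ⟨(h₁r x h).1, by linarith [(h₁r x h).2]⟩
    · have hx' : x ∈ K₂ := hx.resolve_left h
      simp only [h, if_false]
      refine ⟨by linarith [(h₂r x hx').1], ?_⟩
      linarith [dist_triangle_right x x₁ x₂, (h₂r x hx').2]
  · intro x hx y hy
    by_cases h : x ∈ K₁ <;> by_cases h' : y ∈ K₁ <;> simp only [h, h', if_true, if_false]
    · exact h₁d x h y h'
    · refine le_trans ?_ (neg_le_abs _)
      linarith [hcross x h y (hy.resolve_left h')]
    · refine le_trans ?_ (le_abs_self _)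
      have := hcross y h' x (hx.resolve_left h)
      rw [dist_comm] at this
      linarith
    · simpa using h₂d x (hx.resolve_left h) y (hy.resolve_left h')

/-- A family of nonempty toured clusters `K i`, `i ∈ S`, that covers `F`. -/
structure IsTourCover (F : Set Z) (S : Finset Z) (K : Z → Set Z) (ℓ : Z → ℝ) : Prop where
  nonempty : ∀ i ∈ S, (K i).Nonempty
  hasTour : ∀ i ∈ S, HasTour (K i) (ℓ i)
  subset : ∀ i ∈ S, K i ⊆ F
  cover : ∀ x ∈ F, ∃ i ∈ S, x ∈ K i

/-- Distinct clusters are at distance at least `s` from each other. -/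
def IsClusterSeparated (S : Finset Z) (K : Z → Set Z) (s : ℝ) : Prop :=
  ∀ i ∈ S, ∀ j ∈ S, i ≠ j → ∀ x ∈ K i, ∀ y ∈ K j, s ≤ dist x y

/-- Merging clusters that are closer than `s` costs at most `2 * s` for each cluster. -/
lemma IsTourCover.exists_separated {F : Set Z} {s : ℝ} (hs : 0 ≤ s) (n : ℕ) :
    ∀ {S : Finset Z} {K : Z → Set Z} {ℓ : Z → ℝ}, S.card = n → IsTourCover F S K ℓ →
    ∃ (S' : Finset Z) (K' : Z → Set Z) (ℓ' : Z → ℝ), IsTourCover F S' K' ℓ' ∧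
      IsClusterSeparated S' K' s ∧ ∑ i ∈ S', ℓ' i ≤ ∑ i ∈ S, ℓ i + 2 * s * n := by
  classical
  induction n with
  | zero =>
    intro S K ℓ hS h
    rw [Finset.card_eq_zero] at hS
    subst hS
    exact ⟨∅, K, ℓ, h, by simp [IsClusterSeparated], by simp⟩
  | succ n ih =>
    intro S K ℓ hS h
    by_cases hsep : IsClusterSeparated S K s
    · exact ⟨S, K, ℓ, h, hsep, by simp only [le_add_iff_nonneg_right]; positivity⟩
    unfold IsClusterSeparated at hsep
    push Not at hsep
    obtain ⟨i, hi, j, hj, hij, x, hx, y, hy, hxy⟩ := hsep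
    have hi' : i ∈ S.erase j := Finset.mem_erase.2 ⟨hij, hi⟩
    have hupd : IsTourCover F (S.erase j) (Function.update K i (K i ∪ K j))
        (Function.update ℓ i (ℓ i + ℓ j + 2 * s)) := by
      refine ⟨fun k hk => ?_, fun k hk => ?_, fun k hk => ?_, fun z hz => ?_⟩
      · rcases eq_or_ne k i with rfl | hki
        · simpa using Or.inl (h.nonempty k hi)
        · simpa [hki] using h.nonempty k (Finset.mem_of_mem_erase hk)
      · rcases eq_or_ne k i with rfl | hki
        · simpa using (h.hasTour k hi).union (h.hasTour j hj) hx hy hxy.le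
        · simpa [hki] using h.hasTour k (Finset.mem_of_mem_erase hk)
      · rcases eq_or_ne k i with rfl | hki
        · simpa using ⟨h.subset k hi, h.subset j hj⟩
        · simpa [hki] using h.subset k (Finset.mem_of_mem_erase hk)
      · obtain ⟨k, hk, hzk⟩ := h.cover z hz
        by_cases hkij : k = i ∨ k = j
        · refine ⟨i, hi', ?_⟩
          rw [Function.update_self]
          rcases hkij with rfl | rfl
          · exact Or.inl hzk
          · exact Or.inr hzk
        · push Not at hkij
          exact ⟨k, Finset.mem_erase.2 ⟨hkij.2, hk⟩, by simpa [hkij.1] using hzk⟩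
    obtain ⟨S', K', ℓ', hc, hs', hl⟩ := ih (by rw [Finset.card_erase_of_mem hj, hS]; simp) hupd
    refine ⟨S', K', ℓ', hc, hs', hl.trans ?_⟩
    rw [Finset.sum_update_of_mem hi', ← Finset.erase_eq, ← Finset.add_sum_erase S ℓ hj,
      ← Finset.add_sum_erase _ ℓ hi']
    push_cast
    linarith

/-- A set whose finite subsets have tours of bounded length is the image of a set of reals
under a map that does not increase distances. -/
lemma exists_expanding_of_hasTour {E : Set Z} {L : ℝ}
    (h : ∀ F : Set Z, F ⊆ E → F.Finite → F.Nonempty → ∃ ℓ ≤ L, HasTour F ℓ) :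
    ∃ t : Z → ℝ, ∀ x ∈ E, ∀ y ∈ E, dist x y ≤ |t x - t y| := by
  classical
  have key : ∀ F : Finset E, ∃ t : E → ℝ, t ∈ Set.pi Set.univ (fun _ => Set.Icc 0 (max L 0)) ∧
      ∀ x ∈ F, ∀ y ∈ F, dist x y ≤ |t x - t y| := by
    intro F
    rcases F.eq_empty_or_nonempty with rfl | hF
    · exact ⟨fun _ => 0, fun _ _ => ⟨le_rfl, le_max_right _ _⟩, by simp⟩
    set G : Set Z := Subtype.val '' (F : Set E) with hG
    have hmem : ∀ x ∈ F, (x : Z) ∈ G := fun x hx => ⟨x, hx, rfl⟩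
    obtain ⟨ℓ, hℓ, hT⟩ := h G (by rintro _ ⟨x, -, rfl⟩; exact x.2) (F.finite_toSet.image _)
      (hF.to_set.image _)
    obtain ⟨p, hp⟩ := hF
    obtain ⟨t, -, ht, hd⟩ := hT p (hmem p hp)
    refine ⟨fun x => if x ∈ F then t x else 0, fun x _ => ?_, fun x hx y hy => ?_⟩
    · by_cases hx : x ∈ F
      · have := ht x (hmem x hx)
        simp only [hx, if_true]
        refine ⟨this.1, le_max_of_le_left ?_⟩
        linarith [this.2, dist_nonneg (x := (x : Z)) (y := p)]
      · simp [hx]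
    · simpa [hx, hy, Subtype.dist_eq] using hd x (hmem x hx) y (hmem y hy)
  choose t ht hd using key
  let 𝒰 : Ultrafilter (Finset E) := Ultrafilter.of atTop
  have hcomp : IsCompact (Set.pi Set.univ fun _ : E => Set.Icc (0 : ℝ) (max L 0)) :=
    isCompact_univ_pi fun _ => isCompact_Icc
  obtain ⟨τ, -, hτ⟩ := hcomp.ultrafilter_le_nhds (𝒰.map t)
    (le_principal_iff.2 (Ultrafilter.mem_map.2 (univ_mem' ht)))
  have hlim : ∀ x : E, Tendsto (fun F => t F x) 𝒰 (𝓝 (τ x)) := fun x =>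
    (tendsto_pi_nhds.1 (show Tendsto t 𝒰 (𝓝 τ) from hτ)) x
  refine ⟨fun x => if hx : x ∈ E then τ ⟨x, hx⟩ else 0, fun x hx y hy => ?_⟩
  simp only [hx, hy, dif_pos]
  refine ge_of_tendsto ((hlim ⟨x, hx⟩).sub (hlim ⟨y, hy⟩)).abs ?_
  have hev : ∀ᶠ F : Finset E in atTop, {⟨x, hx⟩, ⟨y, hy⟩} ≤ F := eventually_ge_atTop _
  filter_upwards [Ultrafilter.of_le atTop hev] with F hF
  exact hd F ⟨x, hx⟩ (hF (by simp)) ⟨y, hy⟩ (hF (by simp))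

/-- Points whose distances are dominated by differences of real parameters form a Lipschitz image
of a set of reals. -/
lemma exists_lipschitzWith_range_eq {E : Set Z} {t : Z → ℝ}
    (ht : ∀ x ∈ E, ∀ y ∈ E, dist x y ≤ |t x - t y|) :
    ∃ f : t '' E → Z, LipschitzWith 1 f ∧ Set.range f = E := by
  choose g hgE hg using fun a : t '' E => a.2
  refine ⟨g, LipschitzWith.of_dist_le_mul fun a b => ?_, ?_⟩
  · have := ht _ (hgE a) _ (hgE b)
    rw [hg, hg] at this
    simpa [Subtype.dist_eq, Real.dist_eq] using this
  · ext x
    refine ⟨?_, fun hx => ⟨⟨t x, x, hx, rfl⟩, ?_⟩⟩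
    · rintro ⟨a, rfl⟩
      exact hgE a
    · have := ht _ (hgE ⟨t x, x, hx, rfl⟩) x hx
      rw [hg, sub_self, abs_zero] at this
      exact dist_le_zero.1 this

end Tour

section Length

open Metric

variable {Z : Type*} [MetricSpace Z] [MeasurableSpace Z] [BorelSpace Z]

/-- In a connected space, each of at least two `s`-separated clusters is surrounded by a gap that
contains a ball of radius `s / 12` at distance more than `s / 4` from all clusters. -/
lemma IsTourCover.card_mul_add_le {ν : Measure Z} {X F : Set Z} {S : Finset Z} {K : Z → Set Z}
    {ℓ : Z → ℝ} {s b : ℝ} (h : IsTourCover F S K ℓ) (hsep : IsClusterSeparated S K s) (hs : 0 < s)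
    (hX : IsPreconnected X) (hFX : F ⊆ X) (hS : 1 < S.card)
    (hb : ∀ y ∈ X, ∀ x ∈ F, dist y x ≤ 5 * s / 12 → b ≤ ν.real (ball y (s / 12)))
    (hfin : ν (thickening (s / 2) F) ≠ ∞) :
    S.card * b + ν.real (thickening (s / 4) F) ≤ ν.real (thickening (s / 2) F) := by
  have key : ∀ i : Z, ∃ y : Z, i ∈ S → y ∈ X ∧ infDist y (K i) = s / 3 := by
    intro i
    by_cases hi : i ∈ S
    · obtain ⟨j, hj, hji⟩ := Finset.exists_mem_ne hS i
      obtain ⟨p, hp⟩ := h.nonempty i hi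
      obtain ⟨q, hq⟩ := h.nonempty j hj
      have hq' : s / 3 ≤ infDist q (K i) := (le_infDist ⟨p, hp⟩).2 fun z hz => by
        linarith [hsep j hj i hi hji q hq z hz]
      obtain ⟨y, hy, hy'⟩ := hX.intermediate_value (hFX (h.subset i hi hp))
        (hFX (h.subset j hj hq)) (continuous_infDist_pt (K i)).continuousOn
        (show s / 3 ∈ Set.Icc (infDist p (K i)) (infDist q (K i)) from
          ⟨by rw [infDist_zero_of_mem hp]; positivity, hq'⟩)
      exact ⟨y, fun _ => ⟨hy, hy'⟩⟩
    · exact ⟨i, fun h => absurd h hi⟩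
  choose y hy using key
  have hnear : ∀ i ∈ S, ∃ x ∈ K i, dist (y i) x < 5 * s / 12 := fun i hi =>
    (infDist_lt_iff (h.nonempty i hi)).1 (by rw [(hy i hi).2]; linarith)
  have hown : ∀ i ∈ S, ∀ z ∈ ball (y i) (s / 12),
      s / 4 < infDist z (K i) ∧ infDist z (K i) < 5 * s / 12 := by
    intro i hi z hz
    have h1 := infDist_le_infDist_add_dist (s := K i) (x := y i) (y := z)
    have h2 := infDist_le_infDist_add_dist (s := K i) (x := z) (y := y i)
    rw [mem_ball] at hz
    rw [dist_comm] at h1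
    rw [(hy i hi).2] at h1 h2
    constructor <;> linarith
  have hother : ∀ i ∈ S, ∀ z ∈ ball (y i) (s / 12), ∀ j ∈ S, j ≠ i → ∀ x ∈ K j,
      7 * s / 12 < dist z x := by
    intro i hi z hz j hj hji x hx
    obtain ⟨w, hw, hzw⟩ := (infDist_lt_iff (h.nonempty i hi)).1 (hown i hi z hz).2
    linarith [hsep j hj i hi hji x hx w hw, dist_triangle_left x w z]
  have hdisj : (S : Set Z).PairwiseDisjoint fun i => ball (y i) (s / 12) := by
    intro i hi j hj hij
    refine Set.disjoint_left.2 fun z hz hz' => ?_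
    obtain ⟨w, hw, hzw⟩ := (infDist_lt_iff (h.nonempty j hj)).1 (hown j hj z hz').2
    linarith [hother i hi z hz j hj hij.symm w hw]
  set U : Set Z := ⋃ i ∈ S, ball (y i) (s / 12) with hU
  have hUsub : U ⊆ thickening (s / 2) F := by
    intro z hz
    simp only [hU, Set.mem_iUnion] at hz
    obtain ⟨i, hi, hz⟩ := hz
    obtain ⟨w, hw, hzw⟩ := (infDist_lt_iff (h.nonempty i hi)).1 (hown i hi z hz).2
    exact mem_thickening_iff.2 ⟨w, h.subset i hi hw, by linarith⟩
  have hUdisj : Disjoint U (thickening (s / 4) F) := by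
    refine Set.disjoint_left.2 fun z hz hz' => ?_
    simp only [hU, Set.mem_iUnion] at hz
    obtain ⟨i, hi, hz⟩ := hz
    obtain ⟨x, hx, hzx⟩ := mem_thickening_iff.1 hz'
    obtain ⟨j, hj, hxj⟩ := h.cover x hx
    rcases eq_or_ne j i with rfl | hji
    · linarith [(hown j hi z hz).1, infDist_le_dist_of_mem hxj (x := z)]
    · linarith [hother i hi z hz j hj hji x hxj]
  have hUfin : ν U ≠ ∞ := ne_top_of_le_ne_top hfin (measure_mono hUsub)
  have hsub : thickening (s / 4) F ⊆ thickening (s / 2) F := thickening_mono (by linarith) F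
  have hUmeas : S.card * b ≤ ν.real U := by
    rw [hU, measureReal_biUnion_finset hdisj (fun i _ => measurableSet_ball)
      (fun i hi => ne_top_of_le_ne_top hUfin
        (measure_mono (Set.subset_biUnion_of_mem (u := fun i => ball (y i) (s / 12)) hi))),
      ← nsmul_eq_mul]
    refine Finset.card_nsmul_le_sum _ _ _ fun i hi => ?_
    obtain ⟨x, hx, hyx⟩ := hnear i hi
    exact hb _ (hy i hi).1 x (h.subset i hi hx) hyx.le
  calc S.card * b + ν.real (thickening (s / 4) F)
      ≤ ν.real U + ν.real (thickening (s / 4) F) := by gcongr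
    _ = ν.real (U ∪ thickening (s / 4) F) :=
        (measureReal_union hUdisj isOpen_thickening.measurableSet hUfin
          (ne_top_of_le_ne_top hfin (measure_mono hsub))).symm
    _ ≤ ν.real (thickening (s / 2) F) := measureReal_mono (Set.union_subset hUsub hsub) hfin

/-- A finite subset of a connected space has a closed tour of length controlled by the measure of
a neighbourhood, if balls centred near the set have mass at least proportional to their radii. -/
lemma exists_hasTour {ν : Measure Z} {X F : Set Z} {c D : ℝ} (hX : IsPreconnected X)
    (hFX : F ⊆ X) (hF : F.Finite) (hne : F.Nonempty) (hc : 0 < c) (hD : 0 < D)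
    (hdiam : ∀ x ∈ F, ∀ y ∈ F, dist x y ≤ D) (hfin : ν (thickening D F) ≠ ∞)
    (hb : ∀ s, 0 < s → s ≤ D → ∀ y ∈ X, ∀ x ∈ F, dist y x ≤ 5 * s / 12 →
      c * s ≤ ν.real (ball y (s / 12))) :
    ∃ ℓ ≤ 4 / c * ν.real (thickening D F), HasTour F ℓ := by
  let P : ℝ → Prop := fun s => ∃ (S : Finset Z) (K : Z → Set Z) (ℓ : Z → ℝ),
    IsTourCover F S K ℓ ∧ IsClusterSeparated S K s ∧
      ∑ i ∈ S, ℓ i ≤ 4 / c * ν.real (thickening (s / 4) F)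
  have step : ∀ s, 0 < s → s ≤ D → P s → P (2 * s) := by
    rintro s hs hsD ⟨S, K, ℓ, h, hsep, hℓ⟩
    have hfin' : ν (thickening (s / 2) F) ≠ ∞ :=
      ne_top_of_le_ne_top hfin (measure_mono (thickening_mono (by linarith) F))
    have h24 : 2 * s / 4 = s / 2 := by ring
    rcases lt_or_ge 1 S.card with hS | hS
    · have hcount := h.card_mul_add_le hsep hs hX hFX hS (hb s hs hsD) hfin'
      obtain ⟨S', K', ℓ', h', hsep', hℓ'⟩ :=
        h.exists_separated (s := 2 * s) (by positivity) _ rfl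
      refine ⟨S', K', ℓ', h', hsep', ?_⟩
      rw [h24]
      calc ∑ i ∈ S', ℓ' i ≤ 4 / c * ν.real (thickening (s / 4) F) + 2 * (2 * s) * S.card :=
            hℓ'.trans (by gcongr)
        _ = 4 / c * (S.card * (c * s) + ν.real (thickening (s / 4) F)) := by
            field_simp; ring
        _ ≤ 4 / c * ν.real (thickening (s / 2) F) := by gcongr
    · refine ⟨S, K, ℓ, h, ?_, hℓ.trans ?_⟩
      · intro i hi j hj hij
        exact absurd (Finset.card_le_one.1 hS i hi j hj) hij
      · rw [h24]
        gcongr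
        linarith
  have climb : ∀ m : ℕ, P (D / 2 ^ m) → P (2 * D) := by
    intro m
    induction m with
    | zero => intro h; simpa using step D hD le_rfl (by simpa using h)
    | succ m ih =>
      intro h
      refine ih ?_
      have := step (D / 2 ^ (m + 1)) (by positivity)
        (div_le_self hD.le (one_le_pow₀ (by norm_num))) h
      rwa [show 2 * (D / 2 ^ (m + 1)) = D / 2 ^ m by rw [pow_succ]; field_simp] at this
  have base : ∃ m : ℕ, P (D / 2 ^ m) := by
    have hlim : Tendsto (fun m : ℕ => D / 2 ^ m) atTop (𝓝 0) := by
      have := (tendsto_pow_atTop_nhds_zero_of_lt_one (r := (1 / 2 : ℝ)) (by norm_num)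
        (by norm_num)).const_mul D
      simpa [div_eq_mul_inv] using this
    have hev : ∀ᶠ m : ℕ in atTop, ∀ p ∈ F.offDiag, D / 2 ^ m ≤ dist p.1 p.2 :=
      (eventually_all_finite hF.offDiag).2 fun p hp =>
        (hlim.eventually_lt_const (dist_pos.2 hp.2.2)).mono fun _ h => h.le
    obtain ⟨m, hm⟩ := hev.exists
    refine ⟨m, hF.toFinset, fun x => {x}, fun _ => 0, ⟨by simp, fun i _ => hasTour_singleton i,
      by simp, by simp⟩, ?_, by simp; positivity⟩
    rintro i hi j hj hij x rfl y rfl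
    exact hm (x, y) ⟨by simpa using hi, by simpa using hj, hij⟩
  obtain ⟨m, hm⟩ := base
  obtain ⟨S, K, ℓ, h, hsep, hℓ⟩ := climb m hm
  obtain ⟨p, hp⟩ := hne
  obtain ⟨i, hi, hpi⟩ := h.cover p hp
  have huniq : ∀ j ∈ S, j = i := by
    intro j hj
    by_contra hji
    obtain ⟨q, hq⟩ := h.nonempty j hj
    linarith [hsep j hj i hi hji q hq p hpi, hdiam q (h.subset j hj hq) p hp]
  have hS : S = {i} := Finset.eq_singleton_iff_unique_mem.2 ⟨hi, huniq⟩
  have hK : K i = F := by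
    refine (h.subset i hi).antisymm fun x hx => ?_
    obtain ⟨j, hj, hxj⟩ := h.cover x hx
    rwa [← huniq j hj]
  refine ⟨ℓ i, ?_, hK ▸ h.hasTour i hi⟩
  rw [hS, Finset.sum_singleton] at hℓ
  refine hℓ.trans ?_
  gcongr
  linarith

end Length

section Density

open Metric

variable {Z : Type*} [MetricSpace Z] [MeasurableSpace Z]

lemma exists_measure_ball_le_of_lowerDensity_eq_zero {μ : Measure Z} {X : Set Z} {x : Z}
    (h : lowerDensity μ X 1 x = 0) {ε : ℝ} (hε : 0 < ε) :
    ∃ r, 0 < r ∧ r < 1 ∧ μ (ball x r ∩ X) ≤ ENNReal.ofReal (ε * r) := by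
  have hfreq : ∃ᶠ r : ℝ in 𝓝[>] 0,
      μ (ball x r ∩ X) / ENNReal.ofReal (r ^ (1 : ℝ)) < ENNReal.ofReal ε :=
    frequently_lt_of_liminf_lt (h := by
      change lowerDensity μ X 1 x < _
      rw [h]
      exact ENNReal.ofReal_pos.2 hε)
  obtain ⟨r, hr, hr0, hr1⟩ := (hfreq.and_eventually (Ioo_mem_nhdsGT zero_lt_one)).exists
  refine ⟨r, hr0, hr1, ?_⟩
  rw [Real.rpow_one] at hr
  rw [ENNReal.ofReal_mul hε.le]
  exact (ENNReal.div_le_iff (ENNReal.ofReal_pos.2 hr0).ne' ENNReal.ofReal_ne_top).1 hr.le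

lemma exists_le_measure_ball_of_lowerDensity_pos {μ : Measure Z} {X : Set Z} {x : Z}
    (h : 0 < lowerDensity μ X 1 x) {D : ℝ} (hD : 0 < D) :
    ∃ n : ℕ, ∀ r, 0 < r → r ≤ D → ENNReal.ofReal (r / (n + 1)) ≤ μ (ball x r ∩ X) := by
  obtain ⟨a, ha0, ha⟩ := exists_between h
  have hat : a ≠ ∞ := ne_top_of_lt ha
  have ha0' : 0 < a.toReal := ENNReal.toReal_pos ha0.ne' hat
  obtain ⟨δ, hδ, hsmall⟩ := (nhdsGT_basis (0 : ℝ)).eventually_iff.1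
    (eventually_lt_of_lt_liminf ha)
  have hsmall' : ∀ r, 0 < r → r < δ → ENNReal.ofReal (a.toReal * r) ≤ μ (ball x r ∩ X) := by
    intro r hr hrδ
    have := hsmall ⟨hr, hrδ⟩
    rw [Real.rpow_one] at this
    rw [ENNReal.ofReal_mul ha0'.le, ENNReal.ofReal_toReal hat]
    exact (ENNReal.le_div_iff_mul_le (Or.inl (ENNReal.ofReal_pos.2 hr).ne')
      (Or.inl ENNReal.ofReal_ne_top)).1 this.le
  set q : ℝ := min 1 (δ / (2 * D)) with hq
  have hq0 : 0 < q := lt_min one_pos (by positivity)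
  obtain ⟨n, hn⟩ := exists_nat_one_div_lt (mul_pos ha0' hq0)
  refine ⟨n, fun r hr hrD => ?_⟩
  have hqr : q * r < δ := by
    calc q * r ≤ δ / (2 * D) * D := by gcongr; exact min_le_right _ _
      _ = δ / 2 := by field_simp
      _ < δ := by linarith
  calc ENNReal.ofReal (r / (n + 1)) ≤ ENNReal.ofReal (a.toReal * (q * r)) := by
        refine ENNReal.ofReal_le_ofReal ?_
        calc r / (n + 1) = 1 / (n + 1) * r := by ring
          _ ≤ a.toReal * q * r := by gcongr
          _ = a.toReal * (q * r) := by ring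
    _ ≤ μ (ball x (q * r) ∩ X) := hsmall' _ (by positivity) hqr
    _ ≤ μ (ball x r ∩ X) := by
        gcongr
        exact mul_le_of_le_one_left hr.le (min_le_left _ _)

/-- A Lipschitz image of a bounded set of reals on which the lower density vanishes is null. -/
lemma measure_image_eq_zero_of_lowerDensity_eq_zero {μ : Measure Z} {X : Set Z} {A : Set ℝ}
    {f : A → Z} {K : ℝ≥0} (hf : LipschitzWith K f) {T : Set A} {R : ℝ}
    (hR : ∀ a ∈ T, |(a : ℝ)| ≤ R) (hX : ∀ a ∈ T, f a ∈ X)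
    (hT : ∀ a ∈ T, lowerDensity μ X 1 (f a) = 0) : μ (f '' T) = 0 := by
  rcases T.eq_empty_or_nonempty with rfl | ⟨a₀, ha₀⟩
  · simp
  have hR0 : 0 ≤ R := (abs_nonneg _).trans (hR a₀ ha₀)
  have hK : (0 : ℝ) < K + 1 := by positivity
  have key : ∀ ε : ℝ, 0 < ε →
      μ (f '' T) ≤ ENNReal.ofReal (3 * (K + 1) * ε) * ENNReal.ofReal (2 * (R + 1)) := by
    intro ε hε
    have hr : ∀ a : A, ∃ r : ℝ, a ∈ T →
        0 < r ∧ r < 1 ∧ μ (ball (f a) r ∩ X) ≤ ENNReal.ofReal (ε * r) := by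
      intro a
      by_cases ha : a ∈ T
      · obtain ⟨r, hr⟩ := exists_measure_ball_le_of_lowerDensity_eq_zero (hT a ha) hε
        exact ⟨r, fun _ => hr⟩
      · exact ⟨0, fun h => absurd h ha⟩
    choose r hr using hr
    set ρ : A → ℝ := fun a => r a / (6 * (K + 1)) with hρ
    have hρ0 : ∀ a ∈ T, 0 < ρ a := fun a ha => div_pos (hr a ha).1 (by positivity)
    have hρ1 : ∀ a ∈ T, ρ a ≤ 1 := fun a ha => by
      rw [hρ, div_le_one (by positivity)]
      linarith [(hr a ha).2.1, K.coe_nonneg]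
    obtain ⟨u, huT, hu, hcov⟩ := Vitali.exists_disjoint_subfamily_covering_enlargement_closedBall
      T (fun a => (a : ℝ)) ρ 1 hρ1 5 (by norm_num)
    have hucount : u.Countable := hu.countable_of_nonempty_interior fun a ha =>
      ⟨a, ball_subset_interior_closedBall (mem_ball_self (hρ0 a (huT ha)))⟩
    have hsub : f '' T ⊆ ⋃ b ∈ u, ball (f b) (r b) ∩ X := by
      rintro _ ⟨a, ha, rfl⟩
      obtain ⟨b, hb, hab⟩ := hcov a ha
      refine Set.mem_biUnion hb ⟨?_, hX a ha⟩
      have h5 : dist (a : ℝ) b ≤ 5 * ρ b := hab (mem_closedBall_self (hρ0 a ha).le)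
      have hrb := (hr b (huT hb)).1
      calc dist (f a) (f b) ≤ K * dist a b := hf.dist_le_mul a b
        _ ≤ (K + 1) * (5 * ρ b) := by
            gcongr
            · linarith
            · exact h5
        _ = 5 / 6 * r b := by rw [hρ]; field_simp
        _ < r b := by linarith
    have hsubR : ⋃ b ∈ u, closedBall (b : ℝ) (ρ b) ⊆ closedBall (0 : ℝ) (R + 1) := by
      refine Set.iUnion₂_subset fun b hb => closedBall_subset_closedBall' ?_
      rw [Real.dist_0_eq_abs]
      linarith [hR b (huT hb), hρ1 b (huT hb)]
    calc μ (f '' T) ≤ μ (⋃ b ∈ u, ball (f b) (r b) ∩ X) := measure_mono hsub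
      _ ≤ ∑' b : u, μ (ball (f b) (r b) ∩ X) := measure_biUnion_le μ hucount _
      _ ≤ ∑' b : u, ENNReal.ofReal (3 * (K + 1) * ε) * volume (closedBall ((b : A) : ℝ) (ρ b)) := by
          refine ENNReal.tsum_le_tsum fun b => (hr b (huT b.2)).2.2.trans_eq ?_
          rw [Real.volume_closedBall, ← ENNReal.ofReal_mul (by positivity)]
          congr 1
          rw [hρ]
          field_simp
          ring
      _ = ENNReal.ofReal (3 * (K + 1) * ε) * volume (⋃ b ∈ u, closedBall (b : ℝ) (ρ b)) := by
          rw [ENNReal.tsum_mul_left, measure_biUnion hucount hu fun _ _ => measurableSet_closedBall]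
      _ ≤ ENNReal.ofReal (3 * (K + 1) * ε) * volume (closedBall (0 : ℝ) (R + 1)) := by gcongr
      _ = _ := by rw [Real.volume_closedBall]
  refine le_antisymm (ENNReal.le_of_forall_pos_le_add fun δ hδ _ => ?_) bot_le
  refine (key (δ / (3 * (K + 1) * (2 * (R + 1)))) (by positivity)).trans_eq ?_
  rw [← ENNReal.ofReal_mul (by positivity), zero_add, ← ENNReal.ofReal_coe_nnreal]
  congr 1
  field_simp

lemma IsOneRectifiable.ae_lowerDensity_pos {μ : Measure Z} {X E : Set Z}
    (h : IsOneRectifiable μ E) (hEX : E ⊆ X) : ∀ᵐ x ∂μ, x ∈ E → 0 < lowerDensity μ X 1 x := by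
  obtain ⟨A, f, hf, hnull⟩ := h
  let T : ℕ → (i : ℕ) → Set (A i) := fun R i =>
    {a | |(a : ℝ)| ≤ R ∧ f i a ∈ X ∧ lowerDensity μ X 1 (f i a) = 0}
  have hT : ∀ R i, μ (f i '' T R i) = 0 := fun R i => by
    obtain ⟨K, hK⟩ := hf i
    exact measure_image_eq_zero_of_lowerDensity_eq_zero hK (fun a ha => ha.1)
      (fun a ha => ha.2.1) (fun a ha => ha.2.2)
  refine measure_mono_null (fun x hx => ?_) (measure_union_null hnull
    (measure_iUnion_null fun R => measure_iUnion_null fun i => hT R i))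
  simp only [Set.mem_compl_iff, Set.mem_ofPred_eq, Classical.not_imp, not_lt, nonpos_iff_eq_zero]
    at hx
  obtain ⟨hxE, hx0⟩ := hx
  by_cases hxr : x ∈ ⋃ i, Set.range (f i)
  · obtain ⟨i, a, rfl⟩ := Set.mem_iUnion.1 hxr
    obtain ⟨R, hR⟩ := exists_nat_ge |(a : ℝ)|
    exact Or.inr (Set.mem_iUnion₂.2 ⟨R, i, a, ⟨hR, hEX hxE, hx0⟩, rfl⟩)
  · exact Or.inl ⟨hxE, hxr⟩

lemma IsDoublingOn.exists_measure_ball_sixteen_le {μ : Measure Z} {X : Set Z}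
    (h : IsDoublingOn μ X) : ∃ C : ℝ, 0 < C ∧ ∀ x ∈ X, ∀ r : ℝ, 0 < r →
      (μ (ball x (16 * r) ∩ X)).toReal ≤ C * (μ (ball x r ∩ X)).toReal := by
  obtain ⟨C, hC⟩ := h.exists_measure_ball_le
  have hC' : ∀ x ∈ X, ∀ r : ℝ, 0 < r →
      (μ (ball x (2 * r) ∩ X)).toReal ≤ (C + 1) * (μ (ball x r ∩ X)).toReal := by
    intro x hx r hr
    have hfin := (h.measure_ball_lt_top x hx r hr).ne
    have := ENNReal.toReal_mono (ENNReal.mul_ne_top ENNReal.coe_ne_top hfin) (hC x hx r hr)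
    rw [ENNReal.toReal_mul, ENNReal.coe_toReal] at this
    linarith [ENNReal.toReal_nonneg (a := μ (ball x r ∩ X))]
  refine ⟨(C + 1) ^ 4, by positivity, fun x hx r hr => ?_⟩
  calc (μ (ball x (16 * r) ∩ X)).toReal = (μ (ball x (2 * (2 * (2 * (2 * r)))) ∩ X)).toReal := by
        ring_nf
    _ ≤ (C + 1) * ((C + 1) * ((C + 1) * ((C + 1) * (μ (ball x r ∩ X)).toReal))) := by
        refine (hC' x hx _ (by positivity)).trans ?_
        gcongr
        refine (hC' x hx _ (by positivity)).trans ?_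
        gcongr
        refine (hC' x hx _ (by positivity)).trans ?_
        gcongr
        exact hC' x hx r hr
    _ = (C + 1) ^ 4 * (μ (ball x r ∩ X)).toReal := by ring

variable [BorelSpace Z]

/-- In a connected doubling space, a bounded set of points whose balls have mass at least
proportional to their radii embeds expandingly into the line. -/
lemma IsDoublingOn.exists_expanding {μ : Measure Z} {X E : Set Z} {a D : ℝ}
    (h : IsDoublingOn μ X) (hX : IsPreconnected X) (hEX : E ⊆ X) (ha : 0 < a) (hD : 0 < D)
    (hdiam : ∀ x ∈ E, ∀ y ∈ E, dist x y ≤ D)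
    (hE : ∀ x ∈ E, ∀ r, 0 < r → r ≤ D → ENNReal.ofReal (a * r) ≤ μ (ball x r ∩ X)) :
    ∃ t : Z → ℝ, ∀ x ∈ E, ∀ y ∈ E, dist x y ≤ |t x - t y| := by
  rcases E.eq_empty_or_nonempty with rfl | ⟨x₀, hx₀⟩
  · exact ⟨fun _ => 0, by simp⟩
  obtain ⟨C, hC, hdoub⟩ := h.exists_measure_ball_sixteen_le
  set ν : Measure Z := μ.restrict X with hν
  have hball : ∀ x r, ν (ball x r) = μ (ball x r ∩ X) := fun x r =>
    Measure.restrict_apply measurableSet_ball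
  have hsub : thickening D E ⊆ ball x₀ (2 * D) := by
    intro z hz
    obtain ⟨x, hx, hzx⟩ := mem_thickening_iff.1 hz
    rw [mem_ball]
    linarith [dist_triangle z x x₀, hdiam x hx x₀ hx₀]
  have hfin : ν (thickening D E) ≠ ∞ := by
    refine ne_top_of_le_ne_top ?_ (measure_mono hsub)
    rw [hball]
    exact (h.measure_ball_lt_top x₀ (hEX hx₀) _ (by positivity)).ne
  have hb : ∀ s, 0 < s → s ≤ D → ∀ y ∈ X, ∀ x ∈ E, dist y x ≤ 5 * s / 12 →
      a / (2 * C) * s ≤ ν.real (ball y (s / 12)) := by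
    intro s hs hsD y hy x hx hyx
    have hfin' := (h.measure_ball_lt_top y hy (16 * (s / 12)) (by positivity)).ne
    have h1 : a * (s / 2) ≤ (μ (ball y (16 * (s / 12)) ∩ X)).toReal := by
      rw [← ENNReal.ofReal_le_iff_le_toReal hfin']
      refine (hE x hx (s / 2) (by positivity) (by linarith)).trans (measure_mono ?_)
      refine Set.inter_subset_inter_left X (ball_subset_ball' ?_)
      rw [dist_comm]
      linarith
    have h2 := h1.trans (hdoub y hy (s / 12) (by positivity))
    rw [measureReal_def, hball, show a / (2 * C) * s = a * (s / 2) / C by field_simp,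
      div_le_iff₀ hC]
    linarith
  refine exists_expanding_of_hasTour (L := 4 / (a / (2 * C)) * ν.real (thickening D E))
    fun F hFE hF hne => ?_
  have hmono : thickening D F ⊆ thickening D E := thickening_subset_of_subset D hFE
  obtain ⟨ℓ, hℓ, hT⟩ := exists_hasTour (ν := ν) (c := a / (2 * C)) hX (hFE.trans hEX) hF hne
    (by positivity) hD (fun x hx y hy => hdiam x (hFE hx) y (hFE hy))
    (ne_top_of_le_ne_top hfin (measure_mono hmono))
    (fun s hs hsD y hy x hx hyx => hb s hs hsD y hy x (hFE hx) hyx)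
  exact ⟨ℓ, hℓ.trans (by gcongr), hT⟩

lemma IsDoublingOn.isOneRectifiable {μ : Measure Z} {X E : Set Z} (h : IsDoublingOn μ X)
    (hX : IsPreconnected X) (hEX : E ⊆ X) (hE : Bornology.IsBounded E)
    (hpos : ∀ᵐ x ∂μ, x ∈ E → 0 < lowerDensity μ X 1 x) : IsOneRectifiable μ E := by
  obtain ⟨D₀, hD₀⟩ := isBounded_iff.1 hE
  set D : ℝ := max D₀ 1 with hDdef
  have hD : 0 < D := lt_max_of_lt_right one_pos
  let E' : ℕ → Set Z := fun n =>
    {x ∈ E | ∀ r, 0 < r → r ≤ D → ENNReal.ofReal (r / (n + 1)) ≤ μ (ball x r ∩ X)}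
  have key : ∀ n, ∃ (A : Set ℝ) (f : A → Z), LipschitzWith 1 f ∧ Set.range f = E' n := by
    intro n
    obtain ⟨t, ht⟩ := h.exists_expanding (E := E' n) (a := 1 / (n + 1)) hX (fun x hx => hEX hx.1)
      (by positivity) hD (fun x hx y hy => (hD₀ hx.1 hy.1).trans (le_max_left _ _))
      (fun x hx r hr hrD => by simpa [div_eq_inv_mul] using hx.2 r hr hrD)
    exact ⟨t '' E' n, exists_lipschitzWith_range_eq ht⟩
  choose A f hf hrange using key
  refine ⟨A, f, fun i => ⟨1, hf i⟩, measure_mono_null (fun x hx => ?_) (ae_iff.1 hpos)⟩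
  intro hx'
  refine hx.2 ?_
  obtain ⟨n, hn⟩ := exists_le_measure_ball_of_lowerDensity_pos (hx' hx.1) hD
  refine Set.mem_iUnion.2 ⟨n, ?_⟩
  rw [hrange]
  exact ⟨hx.1, hn⟩

end Density

theorem mainTheorem1 {Z : Type*} [MetricSpace Z] [MeasurableSpace Z] [BorelSpace Z]
    (μ : Measure Z) (X : Set Z) (hsupp : μ.support = X) (hconn : IsConnected X)
    (hdoubling : IsDoublingOn μ X) (E : Set Z) (hE : IsCompact E) (hEX : E ⊆ X) :
    IsOneRectifiable μ E ↔ ∀ᵐ x ∂μ, x ∈ E → 0 < lowerDensity μ X 1 x := by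
  subst hsupp
  exact ⟨fun h => h.ae_lowerDensity_pos hEX,
    hdoubling.isOneRectifiable hconn.isPreconnected hEX hE.isBounded⟩
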